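/- Let $n\ge 1$ and let $\mathfrak a_1,\dots,\mathfrak a_N\in\mathbb Z^n$ be vectors which generate a sublattice of rank $n$ and for which there is $\mathfrak a_0^\vee\in(\mathbb Z^n)^\vee$ with $\mathfrak a_0^\vee\cdot\mathfrak a_i=1$ for all $i$. Let $\mathsf A=(a_{rj})$ be the $n\times N$ matrix with columns $\mathfrak a_1,\dots,\mathfrak a_N$ and let $\Delta=\mathrm{conv}\{\mathfrak a_1,\dots,\mathfrak a_N\}\subset\mathbb R^n$. Regular triangulations. For $d\in\mathbb R_{>0}^N$ and $I=\{i_1<\dots<i_n\}\subset\{1,\dots,N\}$ such that $(\mathfrak a_i)_{i\in I}$ is linearly independent put $$D_{d,I}(x)=\det\begin{pmatrix} d_{i_1}^{-1}\mathfrak a_{i_1}&\cdots&d_{i_n}^{-1}\mathfrak a_{i_n}&x\\ 1&\cdots&1&1\end{pmatrix}\qquad(x\in\mathbb R^n).$$ Assume that $d$ is generic: $D_{d,I}(d_j^{-1}\mathfrak a_j)\ne0$ for all such $I$ and all $j\notin I$. The regular triangulation $\mathcal T$ of $\Delta$ given by $d$ has as maximal simplices the sets $I$ as above with $D_{d,I}(d_j^{-1}\mathfrak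 a_j)\,D_{d,I}(0)>0$ for all $j\notin I$; its simplices, identified with the index sets of their vertices, are all subsets of maximal simplices, including $\emptyset$. Let $\mathcal T$ be any regular triangulation of $\Delta$, i.e. one that arises in this way from some $d$, and let $\mathcal T^m$ be the set of its simplices with $m$ vertices. Let $D=\prod_{I\in\mathcal T^n}|\det(\mathfrak a_i)_{i\in I}|$ and $$\mathcal R_{\mathsf A,\mathcal T}=\mathbb Z[D^{-1}][C_1,\dots,C_N]/\mathcal J ,$$ where $\mathcal J$ is the ideal generated by the linear forms $a_{r1}C_1+\dots+a_{rN}C_N$ ($1\le r\le n$) and by the monomials $\prod_{i\in S}C_i$ for all $S\subset\{1,\dots,N\}$ with $S\notin\mathcal T$. Let $c_i$ be the class of $C_i$, and let $\mathcal R^{(k)}_{\mathsf A,\mathcal T}$ be the image of the homogeneous polynomials of degree $k$. Then: 1. $\mathcal R_{\mathsf A,\mathcal T}$ is a free $\mathbb Z[D^{-1}]$-module of finite rank $\#\mathcal T^n$. 2. $\mathcal R_{\mathsf A,\mathcal T}$ is a graded ring (a graded $\mathbb Z[D^{-1}]$-algebra) with homogeneous components $\mathcal R^{(k)}_{\mathsf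 A,\mathcal T}$, $k\ge 0$; these are free $\mathbb Z[D^{-1}]$-modules of finite rank, and $$\sum_{k\ge0}\bigl(\mathrm{rank}\,\mathcal R^{(k)}_{\mathsf A,\mathcal T}\bigr)\tau^k=\sum_{m=0}^n\#(\mathcal T^m)\,\tau^m(1-\tau)^{n-m}.$$ Moreover $\mathcal R^{(k)}_{\mathsf A,\mathcal T}=0$ for all $k\ge n$. 3. Let $\xi\in\Delta$ be any vector which is not in the linear span of any $n-1$ of the vectors $\mathfrak a_1,\dots,\mathfrak a_N$. For $I\in\mathcal T^n$ write $\xi=\sum_{i\in I}x_i\mathfrak a_i$ and put $I^-=\{i\in I\mid x_i<0\}$, $c_I=\prod_{i\in I^-}c_i$. Then $(c_I)_{I\in\mathcal T^n}$ is a $\mathbb Z[D^{-1}]$-basis of $\mathcal R_{\mathsf A,\mathcal T}$. -/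

import Mathlib

/-- The integral vector `a i`, regarded as a vector in `ℝⁿ`. -/
def realVec {n N : ℕ} (a : Fin N → Fin n → ℤ) (i : Fin N) : Fin n → ℝ :=
  fun r => (a i r : ℝ)

/-- The standing assumptions on `a_1, …, a_N ∈ ℤⁿ`: they generate a sublattice of rank `n`, and
they lie on an integral affine hyperplane `a₀ · x = 1`. -/
structure GKZCondition {n N : ℕ} (a : Fin N → Fin n → ℤ) : Prop where
  rank_eq : Module.finrank ℤ (Submodule.span ℤ (Set.range a)) = n
  hyperplane : ∃ a₀ : Fin n → ℤ, ∀ i, a₀ ⬝ᵥ a i = 1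

/-- The polytope `Δ = conv {a_1, …, a_N}` in `ℝⁿ`. -/
def polytope {n N : ℕ} (a : Fin N → Fin n → ℤ) : Set (Fin n → ℝ) :=
  convexHull ℝ (Set.range (realVec a))

/-- The square matrix with columns `a_i`, `i ∈ I`, in increasing order of the indices. -/
def columns {n N : ℕ} (a : Fin N → Fin n → ℤ) (I : Finset (Fin N)) (hI : I.card = n) :
    Matrix (Fin n) (Fin n) ℤ :=
  Matrix.of fun r c => a (I.orderEmbOfFin hI c) r

/-- `D_{d,I}(x)`: the determinant of the `(n+1) × (n+1)` matrix with columns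
`(d_i⁻¹ a_i, 1)`, `i ∈ I`, and `(x, 1)`. Its vanishing is the equation of the affine hyperplane
through the points `d_i⁻¹ a_i`, `i ∈ I`. -/
noncomputable def hyperplaneDet {n N : ℕ} (a : Fin N → Fin n → ℤ) (d : Fin N → ℝ)
    (I : Finset (Fin N)) (hI : I.card = n) (x : Fin n → ℝ) : ℝ :=
  (Matrix.fromBlocks
    (Matrix.of fun (r c : Fin n) =>
      (d (I.orderEmbOfFin hI c))⁻¹ * realVec a (I.orderEmbOfFin hI c) r)
    (Matrix.of fun (r : Fin n) (_ : Unit) => x r)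
    (Matrix.of fun (_ : Unit) (_ : Fin n) => (1 : ℝ))
    (Matrix.of fun (_ _ : Unit) => (1 : ℝ))).det

/-- The weights `d` lie on none of the hypersurfaces `D_{d,I}(d_j⁻¹ a_j) = 0`, `j ∉ I`. -/
def IsGenericWeight {n N : ℕ} (a : Fin N → Fin n → ℤ) (d : Fin N → ℝ) : Prop :=
  ∀ (I : Finset (Fin N)) (hI : I.card = n),
    LinearIndependent ℝ (fun i : I => realVec a i) →
    ∀ j, j ∉ I → hyperplaneDet a d I hI ((d j)⁻¹ • realVec a j) ≠ 0

/-- `I` is the index set of a maximal simplex of the triangulation given by the weights `d`: the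
`d_i⁻¹ a_i`, `i ∈ I`, span an affine hyperplane such that all other `d_j⁻¹ a_j` lie strictly on
the same side of it as the origin. -/
def IsMaxSimplex {n N : ℕ} (a : Fin N → Fin n → ℤ) (d : Fin N → ℝ) (I : Finset (Fin N)) : Prop :=
  ∃ hI : I.card = n, LinearIndependent ℝ (fun i : I => realVec a i) ∧
    ∀ j, j ∉ I → 0 <
      hyperplaneDet a d I hI ((d j)⁻¹ • realVec a j) * hyperplaneDet a d I hI 0

/-- `T` is a regular triangulation of `Δ` with vertices among the `a_i`. Every simplex is
represented by the set of indices of its vertices; the empty simplex is included. -/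
def IsRegularTriangulation {n N : ℕ} (a : Fin N → Fin n → ℤ) (T : Finset (Finset (Fin N))) :
    Prop :=
  ∃ d : Fin N → ℝ, (∀ i, 0 < d i) ∧ IsGenericWeight a d ∧
    ∀ J, J ∈ T ↔ ∃ I, IsMaxSimplex a d I ∧ J ⊆ I

/-- `T^m`, the set of simplices of `T` with `m` vertices. -/
def simplices {N : ℕ} (T : Finset (Finset (Fin N))) (m : ℕ) : Finset (Finset (Fin N)) :=
  T.filter fun J => J.card = m

/-- The product `D` of the volumes `|det (a_i)_{i ∈ I}|` of the maximal simplices `I ∈ T^n`. -/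
def volumeProd {n N : ℕ} (a : Fin N → Fin n → ℤ) (T : Finset (Finset (Fin N))) : ℤ :=
  ∏ I ∈ (simplices T n).attach, |(columns a I.1 (Finset.mem_filter.mp I.2).2).det|

/-- The coefficient ring `ℤ[D⁻¹]`. -/
def BaseRing {n N : ℕ} (a : Fin N → Fin n → ℤ) (T : Finset (Finset (Fin N))) : Type :=
  Localization.Away (volumeProd a T)

noncomputable instance BaseRing.instCommRing {n N : ℕ} (a : Fin N → Fin n → ℤ)
    (T : Finset (Finset (Fin N))) : CommRing (BaseRing a T) :=
  inferInstanceAs (CommRing (Localization.Away (volumeProd a T)))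

instance BaseRing.instIsLocalization {n N : ℕ} (a : Fin N → Fin n → ℤ)
    (T : Finset (Finset (Fin N))) : IsLocalization.Away (volumeProd a T) (BaseRing a T) := by
  have e : (Ring.toIntAlgebra (BaseRing a T)) =
      (OreLocalization.instAlgebra : Algebra ℤ (Localization.Away (volumeProd a T))) :=
    Subsingleton.elim (α := Algebra ℤ (BaseRing a T)) _ _
  rw [e]
  exact inferInstanceAs
    (IsLocalization.Away (volumeProd a T) (Localization.Away (volumeProd a T)))

open MvPolynomial in
/-- The ideal generated by the linear forms `a_{r1} C_1 + ⋯ + a_{rN} C_N` and by the monomials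
`∏_{i ∈ S} C_i` for which `S` is not a simplex of `T`. -/
noncomputable def relIdeal {n N : ℕ} (a : Fin N → Fin n → ℤ) (T : Finset (Finset (Fin N))) :
    Ideal (MvPolynomial (Fin N) (BaseRing a T)) :=
  Ideal.span
    (Set.range (fun r : Fin n => ∑ j, C (algebraMap ℤ (BaseRing a T) (a j r)) * X j) ∪
      {p | ∃ S : Finset (Fin N), S ∉ T ∧ p = ∏ i ∈ S, X i})

/-- The ring `R_{A,T}`. -/
abbrev RingAT {n N : ℕ} (a : Fin N → Fin n → ℤ) (T : Finset (Finset (Fin N))) : Type :=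
  MvPolynomial (Fin N) (BaseRing a T) ⧸ relIdeal a T

/-- The class `c_i` of the variable `C_i`. -/
noncomputable def gen {n N : ℕ} (a : Fin N → Fin n → ℤ) (T : Finset (Finset (Fin N)))
    (i : Fin N) : RingAT a T :=
  Ideal.Quotient.mk (relIdeal a T) (MvPolynomial.X i)

/-- The homogeneous component of degree `k`: the classes of the homogeneous polynomials of
degree `k`. -/
noncomputable def component {n N : ℕ} (a : Fin N → Fin n → ℤ) (T : Finset (Finset (Fin N)))
    (k : ℕ) : Submodule (BaseRing a T) (RingAT a T) :=
  (MvPolynomial.homogeneousSubmodule (Fin N) (BaseRing a T) k).map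
    (Ideal.Quotient.mkₐ (BaseRing a T) (relIdeal a T)).toLinearMap

/-- `ξ` lies in `Δ` and is not in the linear span of any `n - 1` of the vectors `a_i`. -/
def IsGenericVector {n N : ℕ} (a : Fin N → Fin n → ℤ) (ξ : Fin n → ℝ) : Prop :=
  ξ ∈ polytope a ∧
    ∀ S : Finset (Fin N), S.card + 1 = n → ξ ∉ Submodule.span ℝ (realVec a '' S)

open Classical in
/-- `I⁻`: the indices `i ∈ I` whose coefficient `x_i` in `ξ = ∑_{j ∈ I} x_j a_j` is negative.
(If `I` is a maximal simplex, these coefficients exist and are unique.) -/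
noncomputable def negPart {n N : ℕ} (a : Fin N → Fin n → ℤ) (ξ : Fin n → ℝ)
    (I : Finset (Fin N)) : Finset (Fin N) :=
  I.filter fun i => ∃ x : Fin N → ℝ, ξ = ∑ j ∈ I, x j • realVec a j ∧ x i < 0

/-- The element `c_I = ∏_{i ∈ I⁻} c_i`. -/
noncomputable def basisElt {n N : ℕ} (a : Fin N → Fin n → ℤ) (T : Finset (Finset (Fin N)))
    (ξ : Fin n → ℝ) (I : Finset (Fin N)) : RingAT a T :=
  ∏ i ∈ negPart a ξ I, gen a T i

/-! For a maximal simplex `I` let `ℓ_I` be the linear functional with `ℓ_I(a_i) = d_i` for `i ∈ I`.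
The sign condition on determinants says exactly that `ℓ_I(a_j) < d_j` for `j ∉ I`, so `T` is the
lower hull of the points `(a_i, d_i)`. A generic `ξ ∈ Δ` orders the maximal simplices by `ℓ_I(ξ)`,
and this gives a shelling with restriction sets `I⁻`. If `I⁻ ⊆ K ≠ I`, evaluating at `ξ = ∑ x_i a_i`
yields `ℓ_K(ξ) < ℓ_I(ξ)` (`IsCell.apply_lt_apply`). Among the maximal simplices containing a face
`S`, one with largest `ℓ_I(ξ)` has `I⁻ ⊆ S`, since otherwise a pivot of linear programming would
increase the value (`IsCell.exists_pivot`). Hence the intervals `[I⁻, I]` partition `T`.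

The rest is algebra of shellings. Over `ℤ[D⁻¹]` the linear forms can be solved for the variables of
any facet, and this makes the Stanley–Reisner ring free over the polynomial ring in the linear
forms, with the monomials of the sets `R I` as basis (`exists_sub_mem`, `eq_zero_of_sum_mem`).
Killing the linear forms leaves a homogeneous basis over `ℤ[D⁻¹]`. Counting faces interval by
interval gives the Hilbert series (`sum_pow_card`), and `|I⁻| < n` because the coordinates of `ξ` in
`I` sum to 1. -/

/-! ### Shellings and the reduction of monomials -/

/-- A cover of a simplicial complex `T` by facets `F I` with restriction sets `R I`, as it arises
from a shelling: the intervals `[R I, F I]` cover `T`, and the facets can be ordered in such a way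
that `R I ⊆ F K` forces `K` to be `I` or strictly below `I`. -/
structure IsShelling {σ ι : Type*} (T : Finset (Finset σ)) (F R : ι → Finset σ) (w : ι → ℝ) :
    Prop where
  mem_iff : ∀ S, S ∈ T ↔ ∃ I, S ⊆ F I
  restr_subset : ∀ I, R I ⊆ F I
  exists_between : ∀ S ∈ T, ∃ I, R I ⊆ S ∧ S ⊆ F I
  lt_of_subset : ∀ I K, R I ⊆ F K → K ≠ I → w K < w I

/-- The square submatrices of `b` with columns indexed by `F I` are invertible, with inverse
`u I`. -/
structure IsFacetInverse {k σ ι ρ : Type*} [CommRing k] [Fintype ρ] [DecidableEq σ]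
    [DecidableEq ρ] (F : ι → Finset σ) (b : ρ → σ → k) (u : ι → σ → ρ → k) : Prop where
  mul_eq : ∀ I, ∀ i ∈ F I, ∀ j ∈ F I, ∑ r, u I i r * b r j = if i = j then 1 else 0
  mul_eq' : ∀ I r s, ∑ j ∈ F I, b r j * u I j s = if r = s then 1 else 0

namespace IsShelling

theorem facet_eq_of_between {σ ι : Type*} {T : Finset (Finset σ)} {F R : ι → Finset σ}
    {w : ι → ℝ} (h : IsShelling T F R w) {S : Finset σ} {I K : ι} (hI : R I ⊆ S)
    (hI' : S ⊆ F I) (hK : R K ⊆ S) (hK' : S ⊆ F K) : I = K := by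
  by_contra hne
  have h1 := h.lt_of_subset I K (hI.trans hK') (Ne.symm hne)
  have h2 := h.lt_of_subset K I (hK.trans hI') hne
  exact lt_asymm h1 h2

variable {k σ ι ρ : Type*} [CommRing k] [Fintype σ] [DecidableEq σ] [Finite ι] [Fintype ρ]
  [DecidableEq ρ] {T : Finset (Finset σ)} {F R : ι → Finset σ} {w : ι → ℝ}
  {b : ρ → σ → k} {u : ι → σ → ρ → k}

/-- Outer induction on `w I`, inner induction on `s`. A variable of `F I` is traded for linear forms
and variables outside `F I`; multiplying by one of the latter leads to a facet of smaller `w`, or to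
zero. The family `W` serves two purposes: constant, it gives generation over the linear forms;
graded, it keeps track of degrees once these forms vanish. -/
theorem monomial_mul_mem (h : IsShelling T F R w) (hu : IsFacetInverse F b u)
    {Q : Type*} [CommRing Q] [Algebra k Q] (x : σ → Q) (hx : ∀ S ∉ T, ∏ i ∈ S, x i = 0)
    (W : ℕ → Submodule k Q) (hW : ∀ I, ∏ i ∈ R I, x i ∈ W (R I).card)
    (hθ : ∀ r d, ∀ q ∈ W d, (∑ j, b r j • x j) * q ∈ W (d + 1)) (I : ι) (s : Multiset σ) :
    (s.map x).prod * ∏ i ∈ R I, x i ∈ W (s.card + (R I).card) := by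
  have wf : WellFounded (fun K I : ι => w K < w I) := by
    have : IsTrans ι (fun K I : ι => w K < w I) := ⟨fun _ _ _ h h' => lt_trans h h'⟩
    have : Std.Irrefl (fun K I : ι => w K < w I) := ⟨fun _ => lt_irrefl _⟩
    exact Finite.wellFounded_of_trans_of_irrefl _
  induction I using wf.induction generalizing s with
  | _ I ih =>
  have key : ∀ (s : Multiset σ) (j : σ), j ∉ F I →
      x j * ((s.map x).prod * ∏ i ∈ R I, x i) ∈ W (s.card + 1 + (R I).card) := by
    intro s j hj
    have hjR : j ∉ R I := fun hj' => hj (h.restr_subset I hj')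
    have e : x j * ((s.map x).prod * ∏ i ∈ R I, x i) =
        (s.map x).prod * ∏ i ∈ insert j (R I), x i := by
      rw [Finset.prod_insert hjR]; ring
    rw [e]
    by_cases hG : insert j (R I) ∈ T
    -- The face `insert j (R I)` lies in the interval of some `K ≠ I`, since `j ∉ F I`. As `R I ⊆ F
    -- K`, the outer induction applies to `K`, with the surplus variables moved into the multiset.
    · obtain ⟨K, hK, hK'⟩ := h.exists_between _ hG
      have hKI : K ≠ I := by
        rintro rfl
        exact hj (hK' (Finset.mem_insert_self _ _))
      have hlt := h.lt_of_subset I K ((Finset.subset_insert _ _).trans hK') hKI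
      have := ih K hlt (s + (insert j (R I) \ R K).val)
      have hc : (insert j (R I) \ R K).card + (R K).card = (R I).card + 1 := by
        rw [Finset.card_sdiff_add_card_eq_card hK, Finset.card_insert_of_notMem hjR]
      have e2 : (s + (insert j (R I) \ R K).val).card + (R K).card
          = s.card + 1 + (R I).card := by
        rw [Multiset.card_add, Finset.card_val]; omega
      rw [e2, Multiset.map_add, Multiset.prod_add, mul_assoc] at this
      rw [← Finset.prod_sdiff hK]
      exact this
    · rw [hx _ hG, mul_zero]
      exact zero_mem _
  induction s using Multiset.induction_on with
  | empty => simpa using hW I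
  | cons i s ihs =>
    rw [Multiset.map_cons, Multiset.prod_cons, Multiset.card_cons, mul_assoc]
    by_cases hi : i ∈ F I
    -- Solve the linear forms for the variables of `F I`.
    · have e : x i = ∑ r, u I i r • (∑ j, b r j • x j)
          - ∑ j ∈ (F I)ᶜ, (∑ r, u I i r * b r j) • x j := by
        have e1 : ∑ r, u I i r • (∑ j, b r j • x j) = ∑ j, (∑ r, u I i r * b r j) • x j := by
          simp_rw [Finset.smul_sum, Finset.sum_smul, smul_smul]
          exact Finset.sum_comm
        rw [e1, ← Finset.sum_add_sum_compl (F I), add_sub_cancel_right,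
          Finset.sum_congr rfl fun j hj => by rw [hu.mul_eq I i hi j hj]]
        simp [hi]
      rw [e, sub_mul, Finset.sum_mul, Finset.sum_mul]
      refine sub_mem (sum_mem fun r _ => ?_) (sum_mem fun j hj => ?_)
      · rw [smul_mul_assoc]
        have := hθ r _ _ ihs
        rw [add_right_comm] at this
        exact Submodule.smul_mem _ _ this
      · rw [smul_mul_assoc]
        exact Submodule.smul_mem _ _ (key s j (Finset.mem_compl.mp hj))
    · exact key s i hi

/-- The interval containing the empty face has `R K = ∅`, so the extra factor disappears. If even `∅
∉ T`, the ring is zero. -/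
theorem monomial_mem (h : IsShelling T F R w) (hu : IsFacetInverse F b u)
    {Q : Type*} [CommRing Q] [Algebra k Q] (x : σ → Q) (hx : ∀ S ∉ T, ∏ i ∈ S, x i = 0)
    (W : ℕ → Submodule k Q) (hW : ∀ I, ∏ i ∈ R I, x i ∈ W (R I).card)
    (hθ : ∀ r d, ∀ q ∈ W d, (∑ j, b r j • x j) * q ∈ W (d + 1)) (s : Multiset σ) :
    (s.map x).prod ∈ W s.card := by
  by_cases hT : ∅ ∈ T
  · obtain ⟨K, hK, -⟩ := h.exists_between _ hT
    have := h.monomial_mul_mem hu x hx W hW hθ K s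
    simpa [Finset.subset_empty.mp hK] using this
  · have h1 : (1 : Q) = 0 := by simpa using hx _ hT
    rw [← mul_one (s.map x).prod, h1, mul_zero]
    exact zero_mem _

theorem aeval_mem (h : IsShelling T F R w) (hu : IsFacetInverse F b u)
    {Q : Type*} [CommRing Q] [Algebra k Q] (x : σ → Q) (hx : ∀ S ∉ T, ∏ i ∈ S, x i = 0)
    (W : ℕ → Submodule k Q) (hW : ∀ I, ∏ i ∈ R I, x i ∈ W (R I).card)
    (hθ : ∀ r d, ∀ q ∈ W d, (∑ j, b r j • x j) * q ∈ W (d + 1)) (M : Submodule k Q)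
    (f : MvPolynomial σ k) (hf : ∀ s ∈ f.support, W s.degree ≤ M) :
    MvPolynomial.aeval x f ∈ M := by
  rw [f.as_sum, map_sum]
  refine sum_mem fun s hs => ?_
  rw [MvPolynomial.aeval_monomial, ← Algebra.smul_def]
  refine Submodule.smul_mem _ _ (hf s hs ?_)
  have := h.monomial_mem hu x hx W hW hθ (Finsupp.toMultiset s)
  rwa [Finsupp.card_toMultiset, Finsupp.toMultiset_map, Finsupp.prod_toMultiset,
    Finsupp.prod_mapDomain_index (by simp) (by simp [pow_add])] at this

end IsShelling

/-! ### The Stanley–Reisner ring over the polynomial ring in the linear forms -/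

open MvPolynomial

/-- The Stanley–Reisner ideal of `T`, generated by the square-free monomials whose support is not
in `T`. -/
noncomputable def stanleyReisnerIdeal (k : Type*) {σ : Type*} [CommRing k] (T : Finset (Finset σ)) :
    Ideal (MvPolynomial σ k) :=
  Ideal.span {p | ∃ S : Finset σ, S ∉ T ∧ p = ∏ i ∈ S, X i}

theorem prod_X_mem_stanleyReisnerIdeal {k σ : Type*} [CommRing k] {T : Finset (Finset σ)}
    {S : Finset σ} (hS : S ∉ T) : ∏ i ∈ S, (X i : MvPolynomial σ k) ∈ stanleyReisnerIdeal k T :=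
  Ideal.subset_span ⟨S, hS, rfl⟩

/-- The linear form with coefficients `c`. -/
noncomputable def linearForm {k σ : Type*} [CommRing k] [Fintype σ] (c : σ → k) :
    MvPolynomial σ k :=
  ∑ j, C (c j) * X j

/-- The linear forms restricted to the variables of a facet are algebraically independent. -/
theorem IsFacetInverse.eq_zero_of_aeval_eq_zero {k σ ι ρ : Type*} [CommRing k] [Fintype ρ]
    [DecidableEq σ] [DecidableEq ρ] {F : ι → Finset σ} {b : ρ → σ → k} {u : ι → σ → ρ → k}
    (hu : IsFacetInverse F b u) (K : ι) (p : MvPolynomial ρ k)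
    (hp : aeval (fun r => ∑ j ∈ F K, C (b r j) * (X j : MvPolynomial σ k)) p = 0) : p = 0 := by
  have e : (aeval (fun j => ∑ s, C (u K j s) * (X s : MvPolynomial ρ k))).comp
      (aeval (fun r => ∑ j ∈ F K, C (b r j) * (X j : MvPolynomial σ k))) =
      AlgHom.id k (MvPolynomial ρ k) := by
    ext1 r
    simp only [AlgHom.comp_apply, aeval_X, map_sum, map_mul, algHom_C, AlgHom.id_apply,
      Finset.mul_sum, algebraMap_eq, ← mul_assoc]
    rw [Finset.sum_comm]
    simp only [← Finset.sum_mul, ← C_mul, ← map_sum, hu.mul_eq']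
    simp
  rw [← AlgHom.id_apply (R := k) p, ← e, AlgHom.comp_apply, hp, map_zero]

namespace IsShelling

variable {k σ ι ρ : Type*} [CommRing k] [Fintype σ] [DecidableEq σ] [Fintype ι] [Fintype ρ]
  [DecidableEq ρ] {T : Finset (Finset σ)} {F R : ι → Finset σ} {w : ι → ℝ}
  {b : ρ → σ → k} {u : ι → σ → ρ → k}

/-- Every polynomial is, modulo the Stanley–Reisner ideal, a combination of the monomials of the
`R I` whose coefficients are polynomials in the linear forms. -/
theorem exists_sub_mem (h : IsShelling T F R w) (hu : IsFacetInverse F b u)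
    (f : MvPolynomial σ k) : ∃ p : ι → MvPolynomial ρ k,
      f - ∑ I, aeval (fun r => linearForm (b r)) (p I) * ∏ i ∈ R I, X i
        ∈ stanleyReisnerIdeal k T := by
  classical
  set θ : ρ → MvPolynomial σ k := fun r => linearForm (b r) with hθ
  set J := stanleyReisnerIdeal k T
  let M : Submodule k (MvPolynomial σ k ⧸ J) :=
    { carrier := {q | ∃ p : ι → MvPolynomial ρ k,
        q = Ideal.Quotient.mk J (∑ I, aeval θ (p I) * ∏ i ∈ R I, X i)}
      zero_mem' := ⟨0, by simp⟩
      add_mem' := by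
        rintro _ _ ⟨p, rfl⟩ ⟨p', rfl⟩
        exact ⟨p + p', by simp [add_mul, Finset.sum_add_distrib]⟩
      smul_mem' := by
        rintro c _ ⟨p, rfl⟩
        refine ⟨c • p, ?_⟩
        simp only [Pi.smul_apply, map_smul, smul_mul_assoc, ← Finset.smul_sum]
        rfl }
  have hM := h.aeval_mem hu (fun i => Ideal.Quotient.mk J (X i))
    (fun S hS => by
      rw [← map_prod]
      exact Ideal.Quotient.eq_zero_iff_mem.mpr (prod_X_mem_stanleyReisnerIdeal hS))
    (fun _ => M)
    (fun I => ⟨Pi.single I 1, by simp [Pi.single_apply, ite_mul]⟩)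
    (by
      rintro r - _ ⟨p, rfl⟩
      refine ⟨fun I => X r * p I, ?_⟩
      have : ∑ j, b r j • Ideal.Quotient.mk J (X j) = Ideal.Quotient.mk J (θ r) := by
        simp only [hθ, linearForm, map_sum, ← smul_eq_C_mul]
        rfl
      rw [this, ← map_mul, Finset.mul_sum]
      simp only [map_mul, aeval_X, mul_assoc])
    M f (fun _ _ => le_rfl)
  obtain ⟨p, hp⟩ := hM
  refine ⟨p, Ideal.Quotient.eq_zero_iff_mem.mp ?_⟩
  rw [map_sub, ← hp, sub_eq_zero]
  have : aeval (fun i => Ideal.Quotient.mk J (X i)) = Ideal.Quotient.mkₐ k J := by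
    ext i; simp
  rw [this]; rfl

/-- The monomials of the `R I` are independent over the polynomials in the linear forms modulo the
Stanley–Reisner ideal. -/
theorem eq_zero_of_sum_mem (h : IsShelling T F R w) (hu : IsFacetInverse F b u)
    (p : ι → MvPolynomial ρ k)
    (hp : ∑ I, aeval (fun r => linearForm (b r)) (p I) * ∏ i ∈ R I, X i
      ∈ stanleyReisnerIdeal k T) : p = 0 := by
  classical
  by_contra hne
  obtain ⟨K₀, hK₀⟩ := Function.ne_iff.mp hne
  -- For the largest `w K` with `p K ≠ 0`, setting the variables outside `F K` to zero kills every
  -- other term: `R I ⊆ F K` would force `w K < w I`.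
  obtain ⟨K, hK, hmax⟩ := (Finset.univ.filter fun I => p I ≠ 0).exists_max_image w
    ⟨K₀, by simpa using hK₀⟩
  simp only [Finset.mem_filter, Finset.mem_univ, true_and] at hK hmax
  apply hK
  let ϕ : MvPolynomial σ k →ₐ[k] MvPolynomial σ k :=
    aeval fun j => if j ∈ F K then X j else 0
  have hϕ : ∀ q ∈ stanleyReisnerIdeal k T, ϕ q = 0 := by
    intro q hq
    have : stanleyReisnerIdeal k T ≤ RingHom.ker ϕ := by
      refine Ideal.span_le.mpr ?_
      rintro _ ⟨S, hS, rfl⟩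
      have : ¬ S ⊆ F K := fun hSK => hS ((h.mem_iff S).mpr ⟨K, hSK⟩)
      obtain ⟨i, hi, hiK⟩ := Finset.not_subset.mp this
      change ϕ _ = 0
      rw [map_prod]
      exact Finset.prod_eq_zero hi (by simp [ϕ, hiK])
    exact this hq
  have h0 := hϕ _ hp
  rw [map_sum, Finset.sum_eq_single K] at h0
  · have e1 : ϕ (∏ i ∈ R K, X i) = monomial (∑ i ∈ R K, Finsupp.single i 1) 1 := by
      rw [monomial_sum_one, map_prod]
      exact Finset.prod_congr rfl fun i hi => by
        simp only [ϕ, aeval_X, if_pos (h.restr_subset K hi)]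
        rfl
    have e2 : ϕ.comp (aeval fun r => linearForm (b r)) =
        aeval (fun r => ∑ j ∈ F K, C (b r j) * (X j : MvPolynomial σ k)) := by
      ext1 r
      simp [ϕ, linearForm, Finset.sum_ite_mem]
    rw [map_mul, e1, ← AlgHom.comp_apply, e2] at h0
    refine hu.eq_zero_of_aeval_eq_zero K (p K) ?_
    -- The monomial of `R K` is cancelled by comparing coefficients at shifted exponents.
    ext m
    have := congrArg (coeff (m + ∑ i ∈ R K, Finsupp.single i 1)) h0
    simpa [coeff_mul_monomial] using this
  · intro I _ hIK
    by_cases hI : p I = 0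
    · simp [hI]
    · have hsub : ¬ R I ⊆ F K := fun hs =>
        absurd (hmax I hI) (not_le.mpr (h.lt_of_subset I K hs (Ne.symm hIK)))
      obtain ⟨i, hi, hiK⟩ := Finset.not_subset.mp hsub
      rw [map_mul, map_prod, Finset.prod_eq_zero hi (by simp [ϕ, hiK]), mul_zero]
  · simp

/-- The monomials of the `R I` are linearly independent modulo the linear forms and the
Stanley–Reisner ideal. -/
theorem linearIndependent (h : IsShelling T F R w) (hu : IsFacetInverse F b u)
    {J : Ideal (MvPolynomial σ k)}
    (hJ : J = Ideal.span (Set.range fun r => linearForm (b r)) ⊔ stanleyReisnerIdeal k T) :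
    LinearIndependent k fun I : ι => Ideal.Quotient.mk J (∏ i ∈ R I, X i) := by
  classical
  rw [Fintype.linearIndependent_iff]
  intro g hg
  set θ : ρ → MvPolynomial σ k := fun r => linearForm (b r) with hθ
  have h1 : ∑ I, C (g I) * ∏ i ∈ R I, (X i : MvPolynomial σ k) ∈ J := by
    rw [← Ideal.Quotient.eq_zero_iff_mem, ← hg]
    simp only [map_sum, ← smul_eq_C_mul]
    rfl
  rw [hJ] at h1
  obtain ⟨y, hy, z, hz, hyz⟩ := Submodule.mem_sup.mp h1
  obtain ⟨f, hf⟩ := (Ideal.mem_span_range_iff_exists_fun).mp hy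
  -- Expanding the multipliers `f r` of the linear forms in the monomials of the `R I` turns the
  -- relation into one over the polynomials in these forms. Its coefficients are `g I` minus terms
  -- without constant part, so their vanishing gives `g I = 0`.
  choose p hp using fun r => h.exists_sub_mem hu (f r)
  have h2 := h.eq_zero_of_sum_mem hu (fun I => C (g I) - ∑ r, p r I * X r) ?_
  · intro I
    have := congrArg constantCoeff (congrFun h2 I)
    simpa using this
  · have e : ∑ I, aeval θ (C (g I) - ∑ r, p r I * X r) * ∏ i ∈ R I, X i =
        z + ∑ r, (f r - ∑ I, aeval θ (p r I) * ∏ i ∈ R I, X i) * θ r := by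
      simp only [map_sub, map_sum, map_mul, aeval_X, sub_mul, Finset.sum_sub_distrib,
        algHom_C, algebraMap_eq]
      rw [← hyz, ← hf]
      have : ∑ I, (∑ r, aeval θ (p r I) * θ r) * ∏ i ∈ R I, X i =
          ∑ r, (∑ I, aeval θ (p r I) * ∏ i ∈ R I, X i) * θ r := by
        simp only [Finset.sum_mul]
        rw [Finset.sum_comm]
        exact Finset.sum_congr rfl fun _ _ => Finset.sum_congr rfl fun _ _ => by ring
      rw [this]; ring
    change ∑ I, aeval θ (C (g I) - ∑ r, p r I * X r) * ∏ i ∈ R I, X i ∈ _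
    rw [e]
    exact add_mem hz (sum_mem fun r _ => Ideal.mul_mem_right _ _ (hp r))

/-- Modulo the linear forms and the Stanley–Reisner ideal, a polynomial is a combination of those
monomials of the `R I` whose degrees occur in it. -/
theorem mk_mem_of_forall_mem (h : IsShelling T F R w) (hu : IsFacetInverse F b u)
    {J : Ideal (MvPolynomial σ k)}
    (hJ : J = Ideal.span (Set.range fun r => linearForm (b r)) ⊔ stanleyReisnerIdeal k T)
    (M : Submodule k (MvPolynomial σ k ⧸ J)) (f : MvPolynomial σ k)
    (hM : ∀ I, ∀ s ∈ f.support, (R I).card = s.degree →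
      Ideal.Quotient.mk J (∏ i ∈ R I, X i) ∈ M) :
    Ideal.Quotient.mk J f ∈ M := by
  classical
  have hM' := h.aeval_mem hu (fun i => Ideal.Quotient.mk J (X i))
    (fun S hS => by
      rw [← map_prod]
      refine Ideal.Quotient.eq_zero_iff_mem.mpr (hJ ▸ ?_)
      exact Ideal.mem_sup_right (prod_X_mem_stanleyReisnerIdeal hS))
    (fun d => Submodule.span k
      ((fun I : ι => Ideal.Quotient.mk J (∏ i ∈ R I, X i)) '' {I | (R I).card = d}))
    (fun I => Submodule.subset_span ⟨I, rfl, map_prod _ _ _⟩)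
    (by
      intro r d q _
      have : ∑ j, b r j • Ideal.Quotient.mk J (X j) =
          Ideal.Quotient.mk J (linearForm (b r)) := by
        simp only [linearForm, map_sum, ← smul_eq_C_mul]
        rfl
      rw [this, Ideal.Quotient.eq_zero_iff_mem.mpr, zero_mul]
      · exact zero_mem _
      · rw [hJ]
        exact Ideal.mem_sup_left (Ideal.subset_span ⟨r, rfl⟩))
    M f (by
      intro s hs
      refine Submodule.span_le.mpr ?_
      rintro _ ⟨I, hI, rfl⟩
      exact hM I s hs hI)
  have : aeval (fun i => Ideal.Quotient.mk J (X i)) = Ideal.Quotient.mkₐ k J := by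
    ext i; simp
  rw [this] at hM'
  exact hM'

end IsShelling

/-! ### Maximal simplices as cells of a lower hull -/

section Functionals

variable {n N : ℕ} {a : Fin N → Fin n → ℤ} {d : Fin N → ℝ} {I K : Finset (Fin N)}

theorem span_image_eq_top_of_linearIndependent (hI : I.card = n)
    (hli : LinearIndependent ℝ (fun i : I => realVec a i)) :
    Submodule.span ℝ (realVec a '' I) = ⊤ := by
  rw [Set.image_eq_range]
  exact hli.span_eq_top_of_card_eq_finrank' (by simp [hI])

theorem linearIndependent_of_span_image_eq_top (hI : I.card = n)
    (hspan : Submodule.span ℝ (realVec a '' I) = ⊤) :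
    LinearIndependent ℝ (fun i : I => realVec a i) := by
  refine linearIndependent_of_top_le_span_of_card_eq_finrank ?_ (by simp [hI])
  rw [Set.image_eq_range] at hspan
  exact hspan.ge

/-- By the Schur complement the determinant is `det A * (1 - 1 A⁻¹ x)`, where `A` has columns `d_i⁻¹
a_i`; the row vector `1 A⁻¹` takes the value 1 on each of them. -/
theorem exists_hyperplaneDet_eq (hd : ∀ i, 0 < d i) (hI : I.card = n)
    (hli : LinearIndependent ℝ (fun i : I => realVec a i)) :
    ∃ (ℓ : (Fin n → ℝ) →ₗ[ℝ] ℝ) (δ : ℝ), δ ≠ 0 ∧ (∀ i ∈ I, ℓ (realVec a i) = d i) ∧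
      ∀ x, hyperplaneDet a d I hI x = δ * (1 - ℓ x) := by
  set A : Matrix (Fin n) (Fin n) ℝ := Matrix.of fun (r c : Fin n) =>
      (d (I.orderEmbOfFin hI c))⁻¹ * realVec a (I.orderEmbOfFin hI c) r with hA
  have hunit : IsUnit A := by
    rw [← Matrix.linearIndependent_cols_iff_isUnit]
    have h1 := hli.comp (I.orderIsoOfFin hI) (I.orderIsoOfFin hI).injective
    exact h1.units_smul fun c => Units.mk0 _ (inv_ne_zero (hd (I.orderEmbOfFin hI c)).ne')
  have hdet : IsUnit A.det := (Matrix.isUnit_iff_isUnit_det A).mp hunit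
  let := A.invertibleOfIsUnitDet hdet
  refine ⟨dotProductBilin ℝ ℝ (Matrix.vecMul 1 A⁻¹), A.det, hdet.ne_zero, ?_, ?_⟩
  · intro i hi
    obtain ⟨c, rfl⟩ : ∃ c, I.orderEmbOfFin hI c = i := by
      have : i ∈ Set.range (I.orderEmbOfFin hI) := by simpa using hi
      exact this
    have e : realVec a (I.orderEmbOfFin hI c) =
        A.mulVec (d (I.orderEmbOfFin hI c) • Pi.single c 1) := by
      ext r
      rw [Matrix.mulVec_smul, Matrix.mulVec_single_one]
      simp [hA, (hd _).ne']
    change Matrix.vecMul 1 A⁻¹ ⬝ᵥ _ = _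
    rw [e, Matrix.dotProduct_mulVec, Matrix.vecMul_vecMul, Matrix.nonsing_inv_mul _ hdet]
    simp
  · intro x
    rw [hyperplaneDet, Matrix.det_fromBlocks₁₁, Matrix.det_unique (n := Unit)]
    congr 1

/-- The functional `ℓ` supports the lower hull of the points `(a_i, d_i)` exactly in the points
with `i ∈ I`. -/
structure IsCell (a : Fin N → Fin n → ℤ) (d : Fin N → ℝ) (I : Finset (Fin N))
    (ℓ : (Fin n → ℝ) →ₗ[ℝ] ℝ) : Prop where
  card_eq : I.card = n
  span_eq : Submodule.span ℝ (realVec a '' I) = ⊤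
  eq : ∀ i ∈ I, ℓ (realVec a i) = d i
  lt : ∀ j ∉ I, ℓ (realVec a j) < d j

theorem linearMap_eq_of_span_image {ℓ ℓ' : (Fin n → ℝ) →ₗ[ℝ] ℝ}
    (hspan : Submodule.span ℝ (realVec a '' I) = ⊤)
    (h : ∀ i ∈ I, ℓ (realVec a i) = ℓ' (realVec a i)) : ℓ = ℓ' := by
  refine LinearMap.ext_on hspan ?_
  rintro _ ⟨i, hi, rfl⟩
  exact h i hi

/-- In the product of the two determinants `δ` occurs squared, so its sign is that of `d j - ℓ
(a_j)`. -/
theorem isMaxSimplex_iff_exists_isCell (hd : ∀ i, 0 < d i) :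
    IsMaxSimplex a d I ↔ ∃ ℓ, IsCell a d I ℓ := by
  have key : ∀ (ℓ : (Fin n → ℝ) →ₗ[ℝ] ℝ) (δ : ℝ) (j : Fin N), δ ≠ 0 →
      (0 < δ * (1 - ℓ ((d j)⁻¹ • realVec a j)) * (δ * (1 - ℓ 0)) ↔ ℓ (realVec a j) < d j) := by
    intro ℓ δ j hδ
    have e : δ * (1 - ℓ ((d j)⁻¹ • realVec a j)) * (δ * (1 - ℓ 0)) =
        (δ ^ 2 * (d j)⁻¹) * (d j - ℓ (realVec a j)) := by
      have := (hd j).ne'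
      simp only [map_smul, map_zero, smul_eq_mul]
      field_simp
      ring
    have hpos : 0 < δ ^ 2 * (d j)⁻¹ := mul_pos (by positivity) (inv_pos.mpr (hd j))
    rw [e, mul_pos_iff_of_pos_left hpos, sub_pos]
  constructor
  · rintro ⟨hI, hli, h⟩
    obtain ⟨ℓ, δ, hδ, hℓ, hdet⟩ := exists_hyperplaneDet_eq hd hI hli
    refine ⟨ℓ, hI, span_image_eq_top_of_linearIndependent hI hli, hℓ, fun j hj => ?_⟩
    have := h j hj
    rwa [hdet, hdet, key ℓ δ j hδ] at this
  · rintro ⟨ℓ, hℓ⟩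
    have hli := linearIndependent_of_span_image_eq_top hℓ.card_eq hℓ.span_eq
    refine ⟨hℓ.card_eq, hli, fun j hj => ?_⟩
    obtain ⟨ℓ', δ, hδ, hℓ', hdet⟩ := exists_hyperplaneDet_eq hd hℓ.card_eq hli
    obtain rfl : ℓ = ℓ' := linearMap_eq_of_span_image hℓ.span_eq fun i hi => by
      rw [hℓ.eq i hi, hℓ' i hi]
    rw [hdet, hdet, key ℓ δ j hδ]
    exact hℓ.lt j hj

theorem IsGenericWeight.apply_ne (hg : IsGenericWeight a d) (hd : ∀ i, 0 < d i)
    (hI : I.card = n) (hspan : Submodule.span ℝ (realVec a '' I) = ⊤)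
    {ℓ : (Fin n → ℝ) →ₗ[ℝ] ℝ} (hℓ : ∀ i ∈ I, ℓ (realVec a i) = d i) {j : Fin N} (hj : j ∉ I) :
    ℓ (realVec a j) ≠ d j := by
  have hli := linearIndependent_of_span_image_eq_top hI hspan
  obtain ⟨ℓ', δ, hδ, hℓ', hdet⟩ := exists_hyperplaneDet_eq hd hI hli
  obtain rfl : ℓ = ℓ' := linearMap_eq_of_span_image hspan fun i hi => by
    rw [hℓ i hi, hℓ' i hi]
  intro h
  apply hg I hI hli j hj
  rw [hdet, map_smul, h, smul_eq_mul, inv_mul_cancel₀ (hd j).ne', sub_self, mul_zero]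

namespace IsCell

variable {ℓ ℓ' : (Fin n → ℝ) →ₗ[ℝ] ℝ} {ξ : Fin n → ℝ}

theorem functional_eq (h : IsCell a d I ℓ) (h' : IsCell a d I ℓ') : ℓ = ℓ' :=
  linearMap_eq_of_span_image h.span_eq fun i hi => by rw [h.eq i hi, h'.eq i hi]

theorem apply_le (h : IsCell a d I ℓ) (j : Fin N) : ℓ (realVec a j) ≤ d j := by
  by_cases hj : j ∈ I
  · exact (h.eq j hj).le
  · exact (h.lt j hj).le

theorem exists_dual (h : IsCell a d I ℓ) : ∃ e : Fin N → (Fin n → ℝ) →ₗ[ℝ] ℝ,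
    (∀ i ∈ I, ∀ j ∈ I, e i (realVec a j) = if i = j then 1 else 0) ∧
    ∀ ξ, ξ = ∑ i ∈ I, e i ξ • realVec a i := by
  classical
  have hli := linearIndependent_of_span_image_eq_top h.card_eq h.span_eq
  let b : Module.Basis I ℝ (Fin n → ℝ) := Module.Basis.mk hli (by
    have := h.span_eq
    rw [Set.image_eq_range] at this
    exact this.ge)
  have hb : ∀ i : I, b i = realVec a i := fun i => Module.Basis.mk_apply _ _ i
  refine ⟨fun i => if hi : i ∈ I then b.coord ⟨i, hi⟩ else 0, ?_, ?_⟩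
  · intro i hi j hj
    simp only [dif_pos hi]
    rw [← hb ⟨j, hj⟩, b.coord_apply, b.repr_self, Finsupp.single_apply]
    simp [eq_comm]
  · intro ξ
    conv_lhs => rw [← b.sum_repr ξ]
    rw [← Finset.sum_coe_sort I]
    exact Finset.sum_congr rfl fun i _ => by simp [hb]

theorem mem_negPart_iff {e : Fin N → (Fin n → ℝ) →ₗ[ℝ] ℝ}
    (he : ∀ i ∈ I, ∀ j ∈ I, e i (realVec a j) = if i = j then 1 else 0)
    (he' : ∀ ξ, ξ = ∑ i ∈ I, e i ξ • realVec a i) (i : Fin N) :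
    i ∈ negPart a ξ I ↔ i ∈ I ∧ e i ξ < 0 := by
  classical
  unfold _root_.negPart
  rw [Finset.mem_filter]
  refine and_congr_right fun hi => ⟨?_, fun h => ⟨fun i => e i ξ, he' ξ, h⟩⟩
  rintro ⟨x, hx, hneg⟩
  rw [hx, map_sum, Finset.sum_congr rfl fun j hj => by rw [map_smul, he i hi j hj]]
  simpa [hi] using hneg

theorem apply_ne_zero (h : IsCell a d I ℓ) (hξ : IsGenericVector a ξ)
    {e : Fin N → (Fin n → ℝ) →ₗ[ℝ] ℝ} (he' : ∀ ξ, ξ = ∑ i ∈ I, e i ξ • realVec a i)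
    {i : Fin N} (hi : i ∈ I) : e i ξ ≠ 0 := by
  intro h0
  refine hξ.2 (I.erase i) (by rw [Finset.card_erase_add_one hi, h.card_eq]) ?_
  rw [he' ξ, ← Finset.add_sum_erase I _ hi, h0, zero_smul, zero_add]
  exact sum_mem fun j hj => Submodule.smul_mem _ _ (Submodule.subset_span ⟨j, hj, rfl⟩)

/-- Expand `ξ` in the vertices of `I`. The functionals agree on `I ∩ K`; on the nonempty set `I \ K`
the coordinates are positive and `ℓ'` is strictly below `d = ℓ`. -/
theorem apply_lt_apply (h : IsCell a d I ℓ) (h' : IsCell a d K ℓ') (hξ : IsGenericVector a ξ)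
    (hsub : negPart a ξ I ⊆ K) (hne : K ≠ I) : ℓ' ξ < ℓ ξ := by
  obtain ⟨e, he, he'⟩ := h.exists_dual
  have hIK : ¬ I ⊆ K := fun hs =>
    hne (Finset.eq_of_subset_of_card_le hs (by rw [h.card_eq, h'.card_eq])).symm
  obtain ⟨i, hi, hiK⟩ := Finset.not_subset.mp hIK
  have hpos : ∀ j ∈ I, j ∉ K → 0 < e j ξ := by
    intro j hj hjK
    refine lt_of_le_of_ne (not_lt.mp fun hneg => ?_) (h.apply_ne_zero hξ he' hj).symm
    exact hjK (hsub ((mem_negPart_iff he he' j).mpr ⟨hj, hneg⟩))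
  rw [he' ξ, map_sum, map_sum]
  refine Finset.sum_lt_sum (fun j hj => ?_) ⟨i, hi, ?_⟩
  · rw [map_smul, map_smul, h.eq j hj, smul_eq_mul, smul_eq_mul]
    by_cases hjK : j ∈ K
    · rw [h'.eq j hjK]
    · exact mul_le_mul_of_nonneg_left (h'.apply_le j) (hpos j hj hjK).le
  · rw [map_smul, map_smul, h.eq i hi, smul_eq_mul, smul_eq_mul]
    exact mul_lt_mul_of_pos_left (h'.lt i hiK) (hpos i hi hiK)

/-- Replacing a vertex with a negative coordinate of `ξ` by a suitable other vertex yields a cell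
whose functional has a larger value in `ξ`. -/
theorem exists_pivot (h : IsCell a d I ℓ) (hd : ∀ i, 0 < d i) (hg : IsGenericWeight a d)
    (hξ : ξ ∈ polytope a) {i : Fin N} (hi : i ∈ negPart a ξ I) :
    ∃ K ℓ', IsCell a d K ℓ' ∧ I.erase i ⊆ K ∧ ℓ ξ < ℓ' ξ := by
  obtain ⟨e, he, he'⟩ := h.exists_dual
  obtain ⟨hiI, hneg⟩ := (mem_negPart_iff he he' i).mp hi
  -- Otherwise the `i`-th coordinate would be nonnegative on all of `Δ`, hence at `ξ`.
  have hex : ∃ j, e i (realVec a j) < 0 := by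
    by_contra! hall
    have : polytope a ⊆ {x | 0 ≤ e i x} := by
      refine convexHull_min ?_ (convex_halfSpace_ge (e i).isLinear 0)
      rintro _ ⟨j, rfl⟩
      exact hall j
    exact absurd (this hξ) (not_le.mpr hneg)
  obtain ⟨j₀, hj₀⟩ := hex
  -- Ratio test: the minimum is the largest `t` for which `ℓ - t • e i` stays at most `d` on all
  -- points, and the minimizing `j` is the entering vertex.
  obtain ⟨j, hj, hmin⟩ := (Finset.univ.filter fun j => e i (realVec a j) < 0).exists_min_image
    (fun j => (d j - ℓ (realVec a j)) / -(e i (realVec a j))) ⟨j₀, by simpa using hj₀⟩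
  simp only [Finset.mem_filter, Finset.mem_univ, true_and] at hj hmin
  set t := (d j - ℓ (realVec a j)) / -(e i (realVec a j)) with ht
  have hjI : j ∉ I := by
    intro hjI
    rw [he i hiI j hjI] at hj
    split_ifs at hj <;> linarith
  have htpos : 0 < t := div_pos (sub_pos.mpr (h.lt j hjI)) (neg_pos.mpr hj)
  have hteq : ℓ (realVec a j) - t * e i (realVec a j) = d j := by
    rw [ht]; field_simp [hj.ne]; ring
  have hjE : j ∉ I.erase i := fun hj' => hjI (Finset.mem_of_mem_erase hj')
  have hcard : (insert j (I.erase i)).card = n := by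
    rw [Finset.card_insert_of_notMem hjE, Finset.card_erase_add_one hiI, h.card_eq]
  have hspan : Submodule.span ℝ (realVec a '' (insert j (I.erase i) : Finset (Fin N))) = ⊤ := by
    have hmem : ∀ l ∈ I.erase i, realVec a l ∈
        Submodule.span ℝ (realVec a '' (insert j (I.erase i) : Finset (Fin N))) := fun l hl =>
      Submodule.subset_span ⟨l, Finset.mem_insert_of_mem hl, rfl⟩
    have hmemj : realVec a j ∈
        Submodule.span ℝ (realVec a '' (insert j (I.erase i) : Finset (Fin N))) :=
      Submodule.subset_span ⟨j, Finset.mem_insert_self _ _, rfl⟩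
    have hmemi : realVec a i ∈
        Submodule.span ℝ (realVec a '' (insert j (I.erase i) : Finset (Fin N))) := by
      have h1 := he' (realVec a j)
      rw [← Finset.add_sum_erase I _ hiI] at h1
      have h2 : e i (realVec a j) • realVec a i =
          realVec a j - ∑ l ∈ I.erase i, e l (realVec a j) • realVec a l :=
        eq_sub_of_add_eq h1.symm
      rw [← Submodule.smul_mem_iff _ hj.ne, h2]
      exact sub_mem hmemj (sum_mem fun l hl => Submodule.smul_mem _ _ (hmem l hl))
    rw [eq_top_iff, ← h.span_eq, Submodule.span_le]
    rintro _ ⟨l, hl, rfl⟩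
    by_cases hli : l = i
    · exact hli ▸ hmemi
    · exact hmem l (Finset.mem_erase.mpr ⟨hli, hl⟩)
  have heq : ∀ l ∈ insert j (I.erase i), (ℓ - t • e i) (realVec a l) = d l := by
    intro l hl
    rw [LinearMap.sub_apply, LinearMap.smul_apply, smul_eq_mul]
    rcases Finset.mem_insert.mp hl with rfl | hl
    · exact hteq
    · obtain ⟨hli, hl⟩ := Finset.mem_erase.mp hl
      rw [he i hiI l hl, if_neg (Ne.symm hli), mul_zero, sub_zero, h.eq l hl]
  refine ⟨insert j (I.erase i), ℓ - t • e i, ⟨hcard, hspan, heq, fun l hl => ?_⟩,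
    Finset.subset_insert _ _, ?_⟩
  -- The choice of `t` gives the weak inequality; genericity of `d` excludes equality.
  · refine lt_of_le_of_ne ?_ (hg.apply_ne hd hcard hspan heq hl)
    rw [LinearMap.sub_apply, LinearMap.smul_apply, smul_eq_mul]
    by_cases hl0 : e i (realVec a l) < 0
    · have := hmin l hl0
      rw [le_div_iff₀ (neg_pos.mpr hl0)] at this
      linarith
    · have := h.apply_le l
      have := mul_nonneg htpos.le (not_lt.mp hl0)
      linarith
  · rw [LinearMap.sub_apply, LinearMap.smul_apply, smul_eq_mul]
    have := mul_neg_of_pos_of_neg htpos hneg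
    linarith

/-- The functional given by `a₀` is 1 on `Δ` and on every `a_i`, so the coordinates of `ξ` in `I`
sum to 1 and cannot all be negative. -/
theorem card_negPart_lt (h : IsCell a d I ℓ) (hn : 0 < n) (ha : GKZCondition a)
    (hξ : ξ ∈ polytope a) : (negPart a ξ I).card < n := by
  obtain ⟨e, he, he'⟩ := h.exists_dual
  obtain ⟨a₀, ha₀⟩ := ha.hyperplane
  let f : (Fin n → ℝ) →ₗ[ℝ] ℝ := dotProductBilin ℝ ℝ fun r => (a₀ r : ℝ)
  have hf : ∀ i, f (realVec a i) = 1 := by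
    intro i
    have := congrArg (Int.cast : ℤ → ℝ) (ha₀ i)
    simpa [f, dotProductBilin, dotProduct, realVec] using this
  have hfξ : f ξ = 1 := by
    have : polytope a ⊆ {x | f x = 1} := by
      refine convexHull_min ?_ (convex_hyperplane f.isLinear 1)
      rintro _ ⟨j, rfl⟩
      exact hf j
    exact this hξ
  have hsub : negPart a ξ I ⊆ I := fun i hi => ((mem_negPart_iff he he' i).mp hi).1
  refine lt_of_lt_of_eq (Finset.card_lt_card
    (Finset.ssubset_iff_subset_ne.mpr ⟨hsub, fun heq => ?_⟩)) h.card_eq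
  have hne : I.Nonempty := by rw [← Finset.card_pos, h.card_eq]; exact hn
  have hsum : ∑ i ∈ I, e i ξ < 0 :=
    Finset.sum_neg (fun i hi => ((mem_negPart_iff he he' i).mp (heq.ge hi)).2) hne
  have hsum1 : ∑ i ∈ I, e i ξ = 1 := by
    rw [← hfξ]
    conv_rhs => rw [he' ξ]
    simp [hf]
  linarith

end IsCell

/-- Supplies a `ξ` for the assertions that do not mention one. Under the surjection `L` the spans of
`n - 1` vectors pull back to proper subspaces of the space of weights. The complements of these
finitely many subspaces meet the open positive orthant in a common point, which is then normalized
to a convex combination. -/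
theorem exists_isGenericVector (hn : 0 < n)
    (hspan : Submodule.span ℝ (Set.range (realVec a)) = ⊤) : ∃ ξ, IsGenericVector a ξ := by
  let L : (Fin N → ℝ) →ₗ[ℝ] (Fin n → ℝ) := Fintype.linearCombination ℝ (realVec a)
  have hL : LinearMap.range L = ⊤ := by
    rw [Fintype.range_linearCombination, hspan]
  have hdense : Dense (⋂ S : {S : Finset (Fin N) // S.card + 1 = n},
      (((Submodule.span ℝ (realVec a '' S)).comap L : Submodule ℝ (Fin N → ℝ)) :
        Set (Fin N → ℝ))ᶜ) := by
    refine dense_iInter_of_isOpen (fun S => (Submodule.closed_of_finiteDimensional _).isOpen_compl)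
      fun S => ?_
    rw [← interior_eq_empty_iff_dense_compl, ← Set.not_nonempty_iff_eq_empty]
    intro hne
    have h1 := Submodule.eq_top_of_nonempty_interior' _ hne
    have h2 : Submodule.span ℝ (realVec a '' S) = ⊤ := by
      rw [eq_top_iff, ← hL]
      rintro _ ⟨w, rfl⟩
      have : w ∈ (Submodule.span ℝ (realVec a '' S)).comap L := h1 ▸ Submodule.mem_top
      exact this
    have h3 := finrank_span_finset_le_card (R := ℝ) (S.1.image (realVec a))
    rw [Finset.coe_image, Set.finrank, h2, finrank_top, Module.finrank_fin_fun] at h3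
    have h4 := Finset.card_image_le (s := S.1) (f := realVec a)
    have := S.2
    omega
  have hopen : IsOpen {w : Fin N → ℝ | ∀ i, 0 < w i} := by
    simp only [Set.ofPred_forall]
    exact isOpen_iInter_of_finite fun i => isOpen_lt continuous_const (continuous_apply i)
  obtain ⟨w, hw, hwS⟩ := hdense.exists_mem_open hopen ⟨1, fun _ => one_pos⟩
  have hN : (Finset.univ : Finset (Fin N)).Nonempty := by
    rw [Finset.univ_nonempty_iff]
    by_contra hempty
    rw [not_nonempty_iff] at hempty
    rw [Set.range_eq_empty, Submodule.span_empty] at hspan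
    have := congrArg (fun p : Submodule ℝ (Fin n → ℝ) => Module.finrank ℝ p) hspan
    simp at this
    omega
  have hpos : 0 < ∑ i, w i := Finset.sum_pos (fun i _ => hwS i) hN
  refine ⟨(∑ i, w i)⁻¹ • L w, ?_, fun S hS hmem => ?_⟩
  · exact Finset.centerMass_mem_convexHull Finset.univ (fun i _ => (hwS i).le) hpos
      fun i _ => Set.mem_range_self i
  · rw [Submodule.smul_mem_iff _ (inv_ne_zero hpos.ne')] at hmem
    exact Set.mem_iInter.mp hw ⟨S, hS⟩ hmem

end Functionals

/-! ### Submodules spanned by parts of a basis -/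

namespace Module.Basis

variable {k ι M : Type*} [CommRing k] [AddCommGroup M] [Module k M]

theorem isInternal_span_image_fiber (c : Module.Basis ι k M) (deg : ι → ℕ) :
    DirectSum.IsInternal fun d => Submodule.span k (c '' {I | deg I = d}) := by
  refine DirectSum.isInternal_submodule_of_iSupIndep_of_iSup_eq_top (fun d => ?_) ?_
  · have h := c.linearIndependent.disjoint_span_image
      (s := {I | deg I = d}) (t := {I | deg I ≠ d})
      (Set.disjoint_left.mpr fun I h h' => h' h)
    refine h.mono_right (iSup₂_le fun d' hd' => Submodule.span_mono (Set.image_mono ?_))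
    rintro I rfl
    exact hd'
  · rw [eq_top_iff, ← c.span_eq, Submodule.span_le]
    rintro _ ⟨I, rfl⟩
    exact Submodule.mem_iSup_of_mem (deg I) (Submodule.subset_span ⟨I, rfl, rfl⟩)

theorem free_span_image (c : Module.Basis ι k M) (s : Set ι) :
    Module.Free k (Submodule.span k (c '' s)) := by
  rw [Set.image_eq_range]
  exact .of_basis (Module.Basis.span (c.linearIndependent.comp _ Subtype.val_injective))

theorem finrank_span_image [Nontrivial k] (c : Module.Basis ι k M) (s : Finset ι) :
    Module.finrank k (Submodule.span k (c '' s)) = s.card := by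
  rw [Set.image_eq_range]
  exact (finrank_span_eq_card (c.linearIndependent.comp (fun i : s => (i : ι))
    Subtype.val_injective)).trans (Fintype.card_coe s)

end Module.Basis

/-! ### Counting faces by intervals -/

namespace IsShelling

/-- A simplicial complex all of whose facets have `n` elements is the disjoint union of the
intervals `[R I, F I]`. -/
theorem sum_pow_card {σ ι A : Type*} [DecidableEq σ] [Fintype ι] [CommRing A]
    {T : Finset (Finset σ)} {F R : ι → Finset σ} {w : ι → ℝ} (h : IsShelling T F R w) {n : ℕ}
    (hF : ∀ I, (F I).card = n) (x : A) :
    ∑ S ∈ T, x ^ S.card * (1 - x) ^ (n - S.card) = ∑ I, x ^ (R I).card := by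
  have hT : T = Finset.univ.biUnion fun I => Finset.Icc (R I) (F I) := by
    ext S
    simp only [Finset.mem_biUnion, Finset.mem_univ, true_and, Finset.mem_Icc]
    exact ⟨h.exists_between S, fun ⟨I, hI⟩ => (h.mem_iff S).mpr ⟨I, hI.2⟩⟩
  rw [hT, Finset.sum_biUnion]
  · refine Finset.sum_congr rfl fun I _ => ?_
    have hdis : ∀ S ∈ (F I \ R I).powerset, Disjoint (R I) S := fun S hS =>
      (Finset.subset_sdiff.mp (Finset.mem_powerset.mp hS)).2.symm
    rw [Finset.Icc_eq_image_powerset (h.restr_subset I), Finset.sum_image]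
    · have hc : (F I \ R I).card = n - (R I).card := by
        rw [Finset.card_sdiff_of_subset (h.restr_subset I), hF]
      -- The binomial theorem for `x + (1 - x) = 1` collapses the sum over one interval to its
      -- lowest term.
      have := Finset.sum_pow_mul_eq_add_pow x (1 - x) (F I \ R I)
      rw [add_sub_cancel, one_pow] at this
      calc _ = x ^ (R I).card * ∑ S ∈ (F I \ R I).powerset,
            x ^ S.card * (1 - x) ^ ((F I \ R I).card - S.card) := ?_
        _ = _ := by rw [this, mul_one]
      rw [Finset.mul_sum]
      refine Finset.sum_congr rfl fun S hS => ?_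
      rw [Finset.card_union_of_disjoint (hdis S hS), pow_add, hc, Nat.sub_sub, mul_assoc]
    · intro S hS S' hS' heq
      have := congrArg (· \ R I) heq
      simpa [Finset.union_sdiff_cancel_left (hdis S hS),
        Finset.union_sdiff_cancel_left (hdis S' hS')] using this
  · intro I _ K _ hne
    refine Finset.disjoint_left.mpr fun S hS hS' => hne ?_
    rw [Finset.mem_Icc] at hS hS'
    exact h.facet_eq_of_between hS.1 hS.2 hS'.1 hS'.2

end IsShelling

/-! ### The shelling of a regular triangulation and the resulting bases -/

section

variable {n N : ℕ} {a : Fin N → Fin n → ℤ} {T : Finset (Finset (Fin N))} {d : Fin N → ℝ}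

theorem mem_simplices_iff_exists_isCell (hd : ∀ i, 0 < d i)
    (hT : ∀ J, J ∈ T ↔ ∃ I, IsMaxSimplex a d I ∧ J ⊆ I) (I : Finset (Fin N)) :
    I ∈ simplices T n ↔ ∃ ℓ, IsCell a d I ℓ := by
  rw [← isMaxSimplex_iff_exists_isCell hd, simplices, Finset.mem_filter, hT]
  constructor
  · rintro ⟨⟨K, hK, hIK⟩, hI⟩
    rwa [Finset.eq_of_subset_of_card_le hIK (by rw [hI, hK.choose])]
  · intro h
    exact ⟨⟨I, h, subset_rfl⟩, h.choose⟩

/-- The order is by `ℓ I ξ`. A facet containing `S` with maximal value has `I⁻ ⊆ S`: a pivot at a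
vertex of `I⁻` outside `S` would keep `S` and increase the value. -/
theorem isShelling_negPart (hd : ∀ i, 0 < d i) (hg : IsGenericWeight a d)
    (hT : ∀ J, J ∈ T ↔ ∃ I, IsMaxSimplex a d I ∧ J ⊆ I) {ξ : Fin n → ℝ}
    (hξ : IsGenericVector a ξ) :
    ∃ w, IsShelling T (fun I : {I // I ∈ simplices T n} => I.1) (fun I => negPart a ξ I.1) w := by
  classical
  choose ℓ hℓ using fun I : {I // I ∈ simplices T n} =>
    (mem_simplices_iff_exists_isCell hd hT I.1).mp I.2
  refine ⟨fun I => ℓ I ξ, ?_, fun I => ?_, ?_, ?_⟩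
  · intro S
    rw [hT]
    constructor
    · rintro ⟨I, hI, hS⟩
      exact ⟨⟨I, (mem_simplices_iff_exists_isCell hd hT I).mpr
        ((isMaxSimplex_iff_exists_isCell hd).mp hI)⟩, hS⟩
    · rintro ⟨I, hS⟩
      exact ⟨I.1, (isMaxSimplex_iff_exists_isCell hd).mpr ⟨_, hℓ I⟩, hS⟩
  · obtain ⟨e, he, he'⟩ := (hℓ I).exists_dual
    exact fun i hi => ((IsCell.mem_negPart_iff he he' i).mp hi).1
  · intro S hS
    obtain ⟨I₀, hI₀, hS₀⟩ := (hT S).mp hS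
    have hmem := (mem_simplices_iff_exists_isCell hd hT I₀).mpr
      ((isMaxSimplex_iff_exists_isCell hd).mp hI₀)
    obtain ⟨I, hI, hmax⟩ := (Finset.univ.filter
      fun I : {I // I ∈ simplices T n} => S ⊆ I.1).exists_max_image (fun I => ℓ I ξ)
      ⟨⟨I₀, hmem⟩, by simpa using hS₀⟩
    simp only [Finset.mem_filter, Finset.mem_univ, true_and] at hI hmax
    refine ⟨I, fun i hi => ?_, hI⟩
    by_contra hiS
    obtain ⟨K, ℓ', hK, hsub, hlt⟩ := (hℓ I).exists_pivot hd hg hξ.1 hi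
    have hKm := (mem_simplices_iff_exists_isCell hd hT K).mpr ⟨ℓ', hK⟩
    have := hmax ⟨K, hKm⟩ ((Finset.subset_erase.mpr ⟨hI, hiS⟩).trans hsub)
    rw [(hℓ ⟨K, hKm⟩).functional_eq hK] at this
    exact absurd hlt (not_lt.mpr this)
  · intro I K hsub hne
    exact (hℓ I).apply_lt_apply (hℓ K) hξ hsub fun h => hne (Subtype.ext h)

theorem exists_isShelling (hn : 0 < n) (ha : GKZCondition a) (hT : IsRegularTriangulation a T) :
    ∃ (R : {I // I ∈ simplices T n} → Finset (Fin N)) (w : _ → ℝ),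
      IsShelling T (fun I => I.1) R w ∧ ∀ I, (R I).card < n := by
  obtain ⟨d, hd, hg, hT⟩ := hT
  by_cases hne : Nonempty {I // I ∈ simplices T n}
  · obtain ⟨I⟩ := hne
    obtain ⟨ℓ, hℓ⟩ := (mem_simplices_iff_exists_isCell hd hT I.1).mp I.2
    obtain ⟨ξ, hξ⟩ := exists_isGenericVector hn
      (top_le_iff.mp (hℓ.span_eq.ge.trans (Submodule.span_mono (Set.image_subset_range _ _))))
    obtain ⟨w, hw⟩ := isShelling_negPart hd hg hT hξ
    refine ⟨_, w, hw, fun I => ?_⟩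
    obtain ⟨ℓ, hℓ⟩ := (mem_simplices_iff_exists_isCell hd hT I.1).mp I.2
    exact hℓ.card_negPart_lt hn ha hξ.1
  -- Without maximal simplices `T` is empty and all conditions hold vacuously, so their existence
  -- need not be derived from the rank condition.
  · have hnone : ∀ I, ¬ IsMaxSimplex a d I := fun I hI =>
      hne ⟨⟨I, (mem_simplices_iff_exists_isCell hd hT I).mpr
        ((isMaxSimplex_iff_exists_isCell hd).mp hI)⟩⟩
    have hempty : ∀ S, S ∉ T := fun S hS =>
      let ⟨I, hI, _⟩ := (hT S).mp hS
      hnone I hI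
    exact ⟨fun I => I.1, 0, ⟨fun S => ⟨fun h => (hempty S h).elim, fun ⟨I, _⟩ => (hne ⟨I⟩).elim⟩,
      fun I => (hne ⟨I⟩).elim, fun S hS => (hempty S hS).elim, fun I => (hne ⟨I⟩).elim⟩,
      fun I => (hne ⟨I⟩).elim⟩

theorem det_columns_ne_zero {I : Finset (Fin N)} (hI : I.card = n)
    (hli : LinearIndependent ℝ (fun i : I => realVec a i)) : (columns a I hI).det ≠ 0 := by
  have hunit : IsUnit ((columns a I hI).map (Int.castRingHom ℝ)) := by
    rw [← Matrix.linearIndependent_cols_iff_isUnit]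
    exact hli.comp (I.orderIsoOfFin hI) (I.orderIsoOfFin hI).injective
  intro h0
  have := ((Matrix.isUnit_iff_isUnit_det _).mp hunit).ne_zero
  rw [← RingHom.mapMatrix_apply, ← RingHom.map_det, h0, map_zero] at this
  exact this rfl

theorem BaseRing.nontrivial (hT : IsRegularTriangulation a T) : Nontrivial (BaseRing a T) := by
  obtain ⟨d, hd, -, hT⟩ := hT
  have hD : volumeProd a T ≠ 0 := by
    refine Finset.prod_ne_zero_iff.mpr fun I _ => abs_ne_zero.mpr ?_
    obtain ⟨ℓ, hℓ⟩ := (mem_simplices_iff_exists_isCell hd hT I.1).mp I.2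
    exact det_columns_ne_zero _ (linearIndependent_of_span_image_eq_top hℓ.card_eq hℓ.span_eq)
  exact (IsLocalization.injective (M := Submonoid.powers (volumeProd a T)) (BaseRing a T)
    (powers_le_nonZeroDivisors_of_noZeroDivisors hD)).nontrivial

/-- Each facet determinant divides `D`, hence is a unit in `ℤ[D⁻¹]`; this is why `D` is inverted. -/
theorem exists_isFacetInverse (a : Fin N → Fin n → ℤ) (T : Finset (Finset (Fin N))) :
    ∃ u, IsFacetInverse (fun I : {I // I ∈ simplices T n} => I.1)
      (fun r j => algebraMap ℤ (BaseRing a T) (a j r)) u := by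
  classical
  have hcard : ∀ I : {I // I ∈ simplices T n}, I.1.card = n := fun I =>
    (Finset.mem_filter.mp I.2).2
  let M : {I // I ∈ simplices T n} → Matrix (Fin n) (Fin n) (BaseRing a T) := fun I =>
    (columns a I.1 (hcard I)).map (algebraMap ℤ (BaseRing a T))
  have hM : ∀ I, IsUnit (M I).det := by
    intro I
    have h1 : (M I).det = algebraMap ℤ (BaseRing a T) (columns a I.1 (hcard I)).det := by
      rw [RingHom.map_det, RingHom.mapMatrix_apply]
    rw [h1]
    refine isUnit_of_dvd_unit (map_dvd _ ?_)
      (IsLocalization.Away.algebraMap_isUnit (S := BaseRing a T) (volumeProd a T))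
    rw [← abs_dvd]
    exact Finset.dvd_prod_of_mem
      (fun I : {I // I ∈ simplices T n} => |(columns a I.1 (hcard I)).det|)
      (Finset.mem_attach _ I)
  let emb : ∀ I : {I // I ∈ simplices T n}, Fin n ≃o I.1 := fun I => I.1.orderIsoOfFin (hcard I)
  have hMe : ∀ I r (j : I.1), M I r ((emb I).symm j) = algebraMap ℤ (BaseRing a T) (a j r) := by
    intro I r j
    change algebraMap ℤ (BaseRing a T) (a (emb I ((emb I).symm j)) r) = _
    rw [OrderIso.apply_symm_apply]
  refine ⟨fun I i s => if hi : i ∈ I.1 then (M I)⁻¹ ((emb I).symm ⟨i, hi⟩) s else 0, ?_, ?_⟩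
  · intro I i hi j hj
    have := congrFun (congrFun (Matrix.nonsing_inv_mul _ (hM I)) ((emb I).symm ⟨i, hi⟩))
      ((emb I).symm ⟨j, hj⟩)
    rw [Matrix.mul_apply, Matrix.one_apply] at this
    simp only [hMe, (emb I).symm.injective.eq_iff, Subtype.mk.injEq] at this
    simpa only [dif_pos hi] using this
  · intro I r s
    have := congrFun (congrFun (Matrix.mul_nonsing_inv _ (hM I)) r) s
    rw [Matrix.mul_apply, Matrix.one_apply] at this
    rw [← this, ← Finset.sum_coe_sort I.1, ← (emb I).symm.toEquiv.sum_comp]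
    exact Finset.sum_congr rfl fun j _ => by
      have h1 := hMe I r j
      simp only [Subtype.coe_eta, j.2, dif_pos]
      rw [← h1]; rfl

theorem relIdeal_eq (a : Fin N → Fin n → ℤ) (T : Finset (Finset (Fin N))) : relIdeal a T =
    Ideal.span (Set.range fun r => linearForm fun j => algebraMap ℤ (BaseRing a T) (a j r)) ⊔
      stanleyReisnerIdeal (BaseRing a T) T := by
  rw [relIdeal, Ideal.span_union]
  rfl

theorem exists_basis_of_isShelling {R : {I // I ∈ simplices T n} → Finset (Fin N)} {w : _ → ℝ}
    (h : IsShelling T (fun I : {I // I ∈ simplices T n} => I.1) R w) :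
    ∃ c : Module.Basis {I // I ∈ simplices T n} (BaseRing a T) (RingAT a T),
      ∀ I, c I = Ideal.Quotient.mk (relIdeal a T) (∏ i ∈ R I, MvPolynomial.X i) := by
  obtain ⟨u, hu⟩ := exists_isFacetInverse a T
  refine ⟨Module.Basis.mk (h.linearIndependent hu (relIdeal_eq a T)) ?_, fun I =>
    Module.Basis.mk_apply _ _ I⟩
  rintro q -
  obtain ⟨f, rfl⟩ := Ideal.Quotient.mk_surjective q
  exact h.mk_mem_of_forall_mem hu (relIdeal_eq a T) _ f fun I _ _ _ =>
    Submodule.subset_span ⟨I, rfl⟩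

/-- The reduction to basis monomials preserves degree. This makes the sum of the components direct,
which is not automatic for images in a quotient. -/
theorem component_eq_span {R : {I // I ∈ simplices T n} → Finset (Fin N)} {w : _ → ℝ}
    (h : IsShelling T (fun I : {I // I ∈ simplices T n} => I.1) R w)
    {c : Module.Basis {I // I ∈ simplices T n} (BaseRing a T) (RingAT a T)}
    (hc : ∀ I, c I = Ideal.Quotient.mk (relIdeal a T) (∏ i ∈ R I, MvPolynomial.X i)) (k : ℕ) :
    component a T k = Submodule.span (BaseRing a T) (c '' {I | (R I).card = k}) := by
  obtain ⟨u, hu⟩ := exists_isFacetInverse a T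
  apply le_antisymm
  · rintro _ ⟨f, hf, rfl⟩
    refine h.mk_mem_of_forall_mem hu (relIdeal_eq a T) _ f fun I s hs hI =>
      Submodule.subset_span ⟨I, ?_, hc I⟩
    have hs' : s.degree = k := by
      by_contra hne
      exact MvPolynomial.mem_support_iff.mp hs
        (((MvPolynomial.mem_homogeneousSubmodule k f).mp hf).coeff_eq_zero hne)
    exact hI.trans hs'
  · rw [Submodule.span_le]
    rintro _ ⟨I, rfl, rfl⟩
    refine ⟨∏ i ∈ R I, MvPolynomial.X i, ?_, (hc I).symm⟩
    have := MvPolynomial.IsHomogeneous.prod (R I)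
      (fun i => (MvPolynomial.X i : MvPolynomial (Fin N) (BaseRing a T))) (fun _ => 1)
      fun i _ => MvPolynomial.isHomogeneous_X _ i
    simpa using this

instance component.gradedMonoid (a : Fin N → Fin n → ℤ) (T : Finset (Finset (Fin N))) :
    SetLike.GradedMonoid (component a T) where
  one_mem := ⟨1, MvPolynomial.isHomogeneous_one _ _,
    map_one (Ideal.Quotient.mk (relIdeal a T))⟩
  mul_mem := by
    rintro k l _ _ ⟨f, hf, rfl⟩ ⟨g, hg, rfl⟩
    exact ⟨f * g, MvPolynomial.IsHomogeneous.mul hf hg,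
      map_mul (Ideal.Quotient.mk (relIdeal a T)) f g⟩

end

theorem mainTheorem2 {n N : ℕ} (hn : 0 < n) (a : Fin N → Fin n → ℤ) (ha : GKZCondition a)
    (T : Finset (Finset (Fin N))) (hT : IsRegularTriangulation a T) :
    (Module.Free (BaseRing a T) (RingAT a T) ∧ Module.Finite (BaseRing a T) (RingAT a T) ∧
      Module.finrank (BaseRing a T) (RingAT a T) = (simplices T n).card) ∧
    (Nonempty (GradedAlgebra (component a T)) ∧
      (∀ k, Module.Free (BaseRing a T) (component a T k) ∧
        Module.Finite (BaseRing a T) (component a T k)) ∧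
      (PowerSeries.mk fun k => (Module.finrank (BaseRing a T) (component a T k) : ℤ)) =
        ∑ m ∈ Finset.range (n + 1),
          ((simplices T m).card : PowerSeries ℤ) * PowerSeries.X ^ m *
            (1 - PowerSeries.X) ^ (n - m) ∧
      ∀ k, n ≤ k → component a T k = ⊥) ∧
    (∀ ξ : Fin n → ℝ, IsGenericVector a ξ →
      ∃ b : Module.Basis {I // I ∈ simplices T n} (BaseRing a T) (RingAT a T),
        ∀ I, b I = basisElt a T ξ I.1) := by
  have := BaseRing.nontrivial hT
  obtain ⟨R, w, h, hR⟩ := exists_isShelling hn ha hT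
  obtain ⟨c, hc⟩ := exists_basis_of_isShelling (a := a) h
  have hcomp := component_eq_span h hc
  refine ⟨⟨.of_basis c, .of_basis c, ?_⟩, ⟨?_, fun k => ?_, ?_, fun k hk => ?_⟩, fun ξ hξ => ?_⟩
  · rw [Module.finrank_eq_card_basis c, Fintype.card_coe]
  · have hint : DirectSum.IsInternal (component a T) := by
      rw [funext hcomp]
      exact c.isInternal_span_image_fiber fun I => (R I).card
    exact ⟨{ component.gradedMonoid a T, hint.chooseDecomposition with }⟩
  · rw [hcomp]
    exact ⟨c.free_span_image _, .span_of_finite _ ((Set.toFinite _).image _)⟩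
  · have hrank : ∀ k, Module.finrank (BaseRing a T) (component a T k) =
        (Finset.univ.filter fun I => (R I).card = k).card := by
      intro k
      rw [hcomp, ← c.finrank_span_image, Finset.coe_filter_univ]
    have hle : ∀ S ∈ T, S.card ∈ Finset.range (n + 1) := by
      intro S hS
      obtain ⟨I, hI⟩ := (h.mem_iff S).mp hS
      rw [Finset.mem_range, Nat.lt_succ_iff, ← (Finset.mem_filter.mp I.2).2]
      exact Finset.card_le_card hI
    calc (PowerSeries.mk fun k => (Module.finrank (BaseRing a T) (component a T k) : ℤ))
        = ∑ I, (PowerSeries.X : PowerSeries ℤ) ^ (R I).card := by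
          ext k
          simp [hrank, PowerSeries.coeff_X_pow, eq_comm]
      _ = ∑ S ∈ T, (PowerSeries.X : PowerSeries ℤ) ^ S.card *
            (1 - PowerSeries.X) ^ (n - S.card) :=
          (h.sum_pow_card (fun I => (Finset.mem_filter.mp I.2).2) _).symm
      _ = _ := by
          rw [← Finset.sum_fiberwise_of_maps_to hle]
          refine Finset.sum_congr rfl fun m _ => ?_
          rw [simplices, mul_assoc, ← nsmul_eq_mul]
          refine Finset.sum_eq_card_nsmul fun S hS => ?_
          rw [(Finset.mem_filter.mp hS).2]
  · rw [hcomp, Submodule.span_eq_bot]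
    rintro _ ⟨I, hI, -⟩
    exact absurd (hI.ge.trans' hk) (not_le.mpr (hR I))
  -- The basis used so far came from an auxiliary generic vector; here the shelling is taken with
  -- respect to the given `ξ`.
  · obtain ⟨d, hd, hg, hT⟩ := hT
    obtain ⟨w, hw⟩ := isShelling_negPart hd hg hT hξ
    obtain ⟨c, hc⟩ := exists_basis_of_isShelling (a := a) hw
    exact ⟨c, fun I => (hc I).trans (map_prod _ _ _)⟩
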